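/- Let $\mathbb D$ be the open unit disc and let $H^2(\mathbb D)$ be the Hilbert space of analytic functions $f(z)=\sum_{n\ge 0}a_nz^n$ on $\mathbb D$ with $\|f\|^2=\sum_{n\ge 0}|a_n|^2<\infty$. For a bounded analytic function $\varphi\in H^\infty(\mathbb D)$ let $T_\varphi f=\varphi f$ be the analytic Toeplitz operator on $H^2(\mathbb D)$; in particular $T_z$ is the shift. A function $\varphi\in H^\infty(\mathbb D)$ is inner if its radial limits exist and have modulus $1$ almost everywhere on the unit circle, and an inner projection is an operator of the form $T_\varphi T_\varphi^*$ with $\varphi$ inner (equivalently, the orthogonal projection of $H^2(\mathbb D)$ onto $\varphi H^2(\mathbb D)$). Let $T$ be a bounded linear operator on $H^2(\mathbb D)$ with $T\neq 0$ and $T\neq I$. If $\ker T$ is $T_z$-invariant, that is, $T_z(\ker T)\subseteq\ker T$ (the case $\ker T=\{0\}$ being allowed), then $T$ is not a product of two inner projections. In particular, this holds for every nonzero $T$ whose kernel is a nonzero $T_z$-invariant subspace. -/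

import Mathlib

noncomputable section

open Filter Topology Complex
open scoped Complex.UnitDisc

/-! ### Power series on circles (auxiliary facts) -/

lemma summable_sq_parseval (b : ℕ → ℂ) (hb : Summable fun n => ‖b n‖) :
    ∃ G : C(AddCircle (1 : ℝ), ℂ),
      (∀ t, HasSum (fun n => b n * (AddCircle.toCircle t : ℂ) ^ n) (G t)) ∧
      HasSum (fun n => ‖b n‖ ^ 2)
        (‖ContinuousMap.toLp (E := ℂ) 2 (AddCircle.haarAddCircle (T := (1 : ℝ))) ℂ G‖ ^ 2) := by
  have hs : Summable fun n : ℕ => b n • (fourier (n : ℤ) : C(AddCircle (1 : ℝ), ℂ)) := by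
    apply Summable.of_norm
    simpa [norm_smul, fourier_norm] using hb
  obtain ⟨G, hG⟩ := hs
  refine ⟨G, fun t => ?_, ?_⟩
  · have h := hG.mapL (ContinuousMap.evalCLM ℂ t)
    have e : ∀ n : ℕ, (ContinuousMap.evalCLM ℂ t)
        (b n • (fourier (n : ℤ) : C(AddCircle (1 : ℝ), ℂ)))
        = b n * (AddCircle.toCircle t : ℂ) ^ n := fun n => by
      simp [fourier_apply, AddCircle.toCircle_nsmul]
    simp only [e] at h
    exact h
  · have h := (hG.mapL (ContinuousMap.toLp (E := ℂ) 2
      (AddCircle.haarAddCircle (T := (1 : ℝ))) ℂ)).tendsto_sum_nat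
    have h2 := (h.norm).pow 2
    have ho := (orthonormal_fourier (T := (1 : ℝ))).comp (fun n : ℕ => (n : ℤ))
      Nat.cast_injective
    rw [hasSum_iff_tendsto_nat_of_nonneg (fun _ => by positivity)]
    refine h2.congr fun N => ?_
    have h3 := ho.inner_sum b b (Finset.range N)
    have h4 : ((‖∑ i ∈ Finset.range N, b i • (fourierLp 2 (i : ℤ) :
        MeasureTheory.Lp ℂ 2 (AddCircle.haarAddCircle (T := (1 : ℝ))))‖ : ℂ)) ^ 2
        = ∑ i ∈ Finset.range N, (‖b i‖ : ℂ) ^ 2 := by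
      refine (inner_self_eq_norm_sq_to_K (𝕜 := ℂ) (∑ i ∈ Finset.range N, b i • (fourierLp 2 (i : ℤ) :
        MeasureTheory.Lp ℂ 2 (AddCircle.haarAddCircle (T := (1 : ℝ)))))).symm.trans ?_
      refine h3.trans (Finset.sum_congr rfl fun i _ => ?_)
      exact Complex.conj_mul' (b i)
    have h5 : ‖∑ i ∈ Finset.range N, b i • (fourierLp 2 (i : ℤ) :
        MeasureTheory.Lp ℂ 2 (AddCircle.haarAddCircle (T := (1 : ℝ))))‖ ^ 2
        = ∑ i ∈ Finset.range N, ‖b i‖ ^ 2 := by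
      apply Complex.ofReal_injective
      rw [Complex.ofReal_pow, Complex.ofReal_sum, h4]
      exact Finset.sum_congr rfl fun i _ => (Complex.ofReal_pow _ _).symm
    rw [← h5]
    simp only [map_smul]

/-- The evaluation points of a power series on the circle of radius `r < 1`. -/
def circlePoint (r : ℝ) (hr0 : 0 ≤ r) (hr : r < 1) (t : AddCircle (1 : ℝ)) : 𝔻 :=
  UnitDisc.mk (r * (AddCircle.toCircle t : ℂ)) (by
    rw [norm_mul, Circle.norm_coe, mul_one, Complex.norm_real, Real.norm_of_nonneg hr0]
    exact hr)

lemma summable_norm_of_disc {b : ℕ → ℂ} (hb : ∀ z : 𝔻, Summable fun n => b n * (z : ℂ) ^ n)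
    {r : ℝ} (hr0 : 0 ≤ r) (hr : r < 1) : Summable fun n => ‖b n * (r : ℂ) ^ n‖ := by
  have := hb (UnitDisc.mk (r : ℂ) (by simpa [abs_of_nonneg hr0] using hr))
  exact this.norm

/-- If `|g| ≤ M |f|` on the disc, the weighted square sums of the Taylor coefficients compare. -/
lemma sum_sq_le_of_disc {a b : ℕ → ℂ} {f g : 𝔻 → ℂ}
    (ha : ∀ z : 𝔻, HasSum (fun n => a n * (z : ℂ) ^ n) (f z))
    (hb : ∀ z : 𝔻, HasSum (fun n => b n * (z : ℂ) ^ n) (g z))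
    {M : ℝ} (hM : ∀ z, ‖g z‖ ≤ M * ‖f z‖) {r : ℝ} (hr0 : 0 ≤ r) (hr : r < 1) :
    ∑' n, ‖b n * (r : ℂ) ^ n‖ ^ 2 ≤ M ^ 2 * ∑' n, ‖a n * (r : ℂ) ^ n‖ ^ 2 := by
  obtain ⟨F, hF, hF2⟩ := summable_sq_parseval _
    (summable_norm_of_disc (fun z => (ha z).summable) hr0 hr)
  obtain ⟨G, hG, hG2⟩ := summable_sq_parseval _
    (summable_norm_of_disc (fun z => (hb z).summable) hr0 hr)
  rw [hF2.tsum_eq, hG2.tsum_eq, ← mul_pow]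
  have eF : ∀ t, F t = f (circlePoint r hr0 hr t) := fun t => by
    refine (hF t).unique ?_
    convert ha (circlePoint r hr0 hr t) using 2 with n
    change _ = a n * ((r : ℂ) * (AddCircle.toCircle t : ℂ)) ^ n
    ring
  have eG : ∀ t, G t = g (circlePoint r hr0 hr t) := fun t => by
    refine (hG t).unique ?_
    convert hb (circlePoint r hr0 hr t) using 2 with n
    change _ = b n * ((r : ℂ) * (AddCircle.toCircle t : ℂ)) ^ n
    ring
  refine pow_le_pow_left₀ (norm_nonneg _) (MeasureTheory.Lp.norm_le_mul_norm_of_ae_le_mul ?_) 2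
  filter_upwards [ContinuousMap.coeFn_toLp (p := 2) (𝕜 := ℂ)
    (AddCircle.haarAddCircle (T := (1 : ℝ))) F, ContinuousMap.coeFn_toLp (p := 2) (𝕜 := ℂ)
    (AddCircle.haarAddCircle (T := (1 : ℝ))) G] with t h1 h2
  rw [h1, h2, eF, eG]
  exact hM _

/-- If `|g| ≤ M |f|` on the disc and `f` has square summable Taylor coefficients, then so has `g`,
with the corresponding bound. -/
lemma summable_sq_of_disc {a b : ℕ → ℂ} {f g : 𝔻 → ℂ}
    (ha : ∀ z : 𝔻, HasSum (fun n => a n * (z : ℂ) ^ n) (f z))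
    (hb : ∀ z : 𝔻, HasSum (fun n => b n * (z : ℂ) ^ n) (g z))
    (ha2 : Summable fun n => ‖a n‖ ^ 2)
    {M : ℝ} (hM : ∀ z, ‖g z‖ ≤ M * ‖f z‖) :
    (Summable fun n => ‖b n‖ ^ 2) ∧ ∑' n, ‖b n‖ ^ 2 ≤ M ^ 2 * ∑' n, ‖a n‖ ^ 2 := by
  have key : ∀ s : Finset ℕ, ∑ n ∈ s, ‖b n‖ ^ 2 ≤ M ^ 2 * ∑' n, ‖a n‖ ^ 2 := by
    intro s
    have hr : ∀ r ∈ Set.Ioo (0 : ℝ) 1,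
        ∑ n ∈ s, ‖b n * (r : ℂ) ^ n‖ ^ 2 ≤ M ^ 2 * ∑' n, ‖a n‖ ^ 2 := by
      intro r hr
      obtain ⟨G, hG, hG2⟩ := summable_sq_parseval _
        (summable_norm_of_disc (fun z => (hb z).summable) hr.1.le hr.2)
      refine (hG2.summable.sum_le_tsum s (fun _ _ => by positivity)).trans ?_
      refine (sum_sq_le_of_disc ha hb hM hr.1.le hr.2).trans ?_
      have hle : ∀ n, ‖a n * (r : ℂ) ^ n‖ ^ 2 ≤ ‖a n‖ ^ 2 := fun n => by
        refine pow_le_pow_left₀ (norm_nonneg _) ?_ 2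
        rw [norm_mul, norm_pow, Complex.norm_real, Real.norm_of_nonneg hr.1.le]
        exact mul_le_of_le_one_right (norm_nonneg _) (pow_le_one₀ hr.1.le hr.2.le)
      exact mul_le_mul_of_nonneg_left (Summable.tsum_le_tsum hle
        (ha2.of_nonneg_of_le (fun _ => by positivity) hle) ha2) (by positivity)
    have hc : Tendsto (fun r : ℝ => ∑ n ∈ s, ‖b n * (r : ℂ) ^ n‖ ^ 2) (𝓝[<] 1)
        (𝓝 (∑ n ∈ s, ‖b n‖ ^ 2)) := by
      have : Continuous (fun r : ℝ => ∑ n ∈ s, ‖b n * (r : ℂ) ^ n‖ ^ 2) := by fun_prop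
      simpa using (this.tendsto 1).mono_left nhdsWithin_le_nhds
    refine le_of_tendsto hc ?_
    filter_upwards [Ioo_mem_nhdsLT (zero_lt_one' ℝ)] with r h using hr r h
  refine ⟨summable_of_sum_le (fun _ => by positivity) key, ?_⟩
  exact Real.tsum_le_of_sum_le (fun _ => by positivity) key

/-! ### The Hardy space of the disc -/

lemma taylor_unique {a b : ℕ → ℂ} {f : 𝔻 → ℂ}
    (ha : ∀ z : 𝔻, HasSum (fun n => a n * (z : ℂ) ^ n) (f z))
    (hb : ∀ z : 𝔻, HasSum (fun n => b n * (z : ℂ) ^ n) (f z)) : a = b := by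
  have h0 : ∀ z : 𝔻, HasSum (fun n => (a n - b n) * (z : ℂ) ^ n) ((fun _ => (0 : ℂ)) z) :=
    fun z => by simpa [sub_mul] using (ha z).sub (hb z)
  have hz : ∀ z : 𝔻, HasSum (fun n => (0 : ℕ → ℂ) n * (z : ℂ) ^ n) ((fun _ => (0 : ℂ)) z) :=
    fun z => by simp
  obtain ⟨h1, h2⟩ := summable_sq_of_disc hz h0 (by simp) (M := 0)
    (by simp)
  funext n
  have h3 := h1.le_tsum n (fun _ _ => by positivity)
  have h4 : ‖a n - b n‖ ^ 2 ≤ 0 := h3.trans (h2.trans (by simp))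
  have h5 : ‖a n - b n‖ = 0 := by
    have := sq_nonneg ‖a n - b n‖
    exact pow_eq_zero_iff (two_ne_zero) |>.1 (le_antisymm h4 this)
  exact sub_eq_zero.1 (norm_eq_zero.1 h5)

/-- The functions on the open unit disc that are given by a power series
`f z = ∑ aₙ zⁿ` (`|z| < 1`) with square summable coefficients. -/
def hardySubmodule : Submodule ℂ (𝔻 → ℂ) where
  carrier := {f | ∃ a : ℕ → ℂ, (Summable fun n => ‖a n‖ ^ 2) ∧
    ∀ z : 𝔻, HasSum (fun n => a n * (z : ℂ) ^ n) (f z)}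
  zero_mem' := ⟨0, by simp, fun z => by simp⟩
  add_mem' := by
    rintro f g ⟨a, ha, haf⟩ ⟨b, hb, hbg⟩
    refine ⟨fun n => a n + b n, ?_, fun z => ?_⟩
    · refine ((ha.mul_left 2).add (hb.mul_left 2)).of_nonneg_of_le (fun _ => by positivity)
        fun n => ?_
      have h1 := norm_add_le (a n) (b n)
      have h2 := norm_nonneg (a n + b n)
      nlinarith [sq_nonneg (‖a n‖ - ‖b n‖)]
    · simpa [add_mul] using (haf z).add (hbg z)
  smul_mem' := by
    rintro c f ⟨a, ha, haf⟩
    refine ⟨fun n => c * a n, ?_, fun z => ?_⟩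
    · simpa [mul_pow] using ha.mul_left (‖c‖ ^ 2)
    · simpa [mul_assoc] using (haf z).mul_left c

/-- The Hardy space `H²(𝔻)`. -/
def Hardy : Type := hardySubmodule

namespace Hardy

instance : AddCommGroup Hardy := inferInstanceAs (AddCommGroup hardySubmodule)
instance : Module ℂ Hardy := inferInstanceAs (Module ℂ hardySubmodule)

instance : CoeFun Hardy (fun _ => 𝔻 → ℂ) := ⟨fun f => f.1⟩

@[ext] lemma ext {f g : Hardy} (h : ∀ z, f z = g z) : f = g := Subtype.ext (funext h)

@[simp] lemma add_apply (f g : Hardy) (z : 𝔻) : (f + g) z = f z + g z := rfl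
@[simp] lemma smul_apply (c : ℂ) (f : Hardy) (z : 𝔻) : (c • f) z = c * f z := rfl
@[simp] lemma zero_apply (z : 𝔻) : (0 : Hardy) z = 0 := rfl

/-- The Taylor coefficients at `0` of a function in the Hardy space. -/
def coeff (f : Hardy) : ℕ → ℂ := f.2.choose

lemma summable_coeff (f : Hardy) : Summable fun n => ‖f.coeff n‖ ^ 2 := f.2.choose_spec.1

lemma hasSum_coeff (f : Hardy) (z : 𝔻) : HasSum (fun n => f.coeff n * (z : ℂ) ^ n) (f z) :=
  f.2.choose_spec.2 z

lemma coeff_eq {f : Hardy} {a : ℕ → ℂ}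
    (h : ∀ z : 𝔻, HasSum (fun n => a n * (z : ℂ) ^ n) (f z)) : f.coeff = a :=
  taylor_unique f.hasSum_coeff h

lemma memℓp_iff_summable_sq (a : ℕ → ℂ) : Memℓp a 2 ↔ Summable fun n => ‖a n‖ ^ 2 := by
  rw [memℓp_gen_iff (by norm_num)]
  simp

/-- The identification of a function in the Hardy space with its sequence of Taylor
coefficients. -/
def coeffEquiv : Hardy ≃ₗ[ℂ] lp (fun _ : ℕ => ℂ) 2 where
  toFun f := ⟨f.coeff, (memℓp_iff_summable_sq _).2 f.summable_coeff⟩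
  map_add' f g := Subtype.ext <| coeff_eq (a := fun n => f.coeff n + g.coeff n) fun z => by
    simpa [add_mul] using (f.hasSum_coeff z).add (g.hasSum_coeff z)
  map_smul' c f := Subtype.ext <| coeff_eq fun z => by
    simpa [mul_assoc] using (f.hasSum_coeff z).mul_left c
  invFun a := ⟨fun z => ∑' n, a n * (z : ℂ) ^ n, a, (memℓp_iff_summable_sq _).1 a.2, fun z => by
    refine Summable.hasSum (Summable.of_norm ?_)
    have h1 := (memℓp_iff_summable_sq _).1 a.2
    have hz : ‖(z : ℂ)‖ ^ 2 < 1 := z.sq_norm_lt_one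
    have h2 := summable_geometric_of_lt_one (by positivity) hz
    refine (h1.add h2).of_nonneg_of_le (fun _ => by positivity) fun n => ?_
    rw [norm_mul, norm_pow, ← pow_mul, mul_comm 2 n, pow_mul]
    nlinarith [sq_nonneg (‖a n‖ - ‖(z : ℂ)‖ ^ n), norm_nonneg (a n), sq_nonneg ‖a n‖,
      sq_nonneg (‖(z : ℂ)‖ ^ n)]⟩
  left_inv f := Hardy.ext fun z => (f.hasSum_coeff z).tsum_eq
  right_inv a := Subtype.ext <| coeff_eq fun z => by
    refine Summable.hasSum (Summable.of_norm ?_)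
    have h1 := (memℓp_iff_summable_sq _).1 a.2
    have hz : ‖(z : ℂ)‖ ^ 2 < 1 := z.sq_norm_lt_one
    have h2 := summable_geometric_of_lt_one (by positivity) hz
    refine (h1.add h2).of_nonneg_of_le (fun _ => by positivity) fun n => ?_
    rw [norm_mul, norm_pow, ← pow_mul, mul_comm 2 n, pow_mul]
    nlinarith [sq_nonneg (‖a n‖ - ‖(z : ℂ)‖ ^ n), norm_nonneg (a n), sq_nonneg ‖a n‖,
      sq_nonneg (‖(z : ℂ)‖ ^ n)]

@[simp] lemma coeffEquiv_apply (f : Hardy) (n : ℕ) : coeffEquiv f n = f.coeff n := rfl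

/-- The norm of `H²(𝔻)`: `‖f‖² = ∑ |aₙ|²`, where `f z = ∑ aₙ zⁿ`. -/
instance : NormedAddCommGroup Hardy :=
  NormedAddCommGroup.induced Hardy (lp (fun _ : ℕ => ℂ) 2) coeffEquiv coeffEquiv.injective

/-- The inner product of `H²(𝔻)`: `⟪f, g⟫ = ∑ conj(aₙ) bₙ`. -/
instance : InnerProductSpace ℂ Hardy where
  norm_smul_le c f := by
    change ‖coeffEquiv (c • f)‖ ≤ ‖c‖ * ‖coeffEquiv f‖
    rw [map_smul, norm_smul]
  inner f g := inner ℂ (coeffEquiv f) (coeffEquiv g)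
  norm_sq_eq_re_inner f := InnerProductSpace.norm_sq_eq_re_inner (𝕜 := ℂ) (coeffEquiv f)
  conj_inner_symm f g := InnerProductSpace.conj_inner_symm (𝕜 := ℂ) (coeffEquiv f) (coeffEquiv g)
  add_left f g h := by rw [map_add, inner_add_left]
  smul_left f g c := by rw [map_smul, inner_smul_left]

lemma inner_eq (f g : Hardy) :
    inner ℂ f g = ∑' n, (starRingEnd ℂ) (f.coeff n) * g.coeff n := by
  change inner ℂ (coeffEquiv f) (coeffEquiv g) = _
  rw [lp.inner_eq_tsum]
  exact tsum_congr fun n => mul_comm _ _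

lemma norm_sq_eq (f : Hardy) : ‖f‖ ^ 2 = ∑' n, ‖f.coeff n‖ ^ 2 := by
  have h := lp.norm_rpow_eq_tsum (p := 2) (by norm_num) (coeffEquiv f)
  change ‖coeffEquiv f‖ ^ 2 = _
  simpa using h

/-- Taking Taylor coefficients is a unitary map onto `ℓ²`. -/
def coeffIsometry : Hardy ≃ₗᵢ[ℂ] lp (fun _ : ℕ => ℂ) 2 :=
  { coeffEquiv with norm_map' := fun _ => rfl }

instance : CompleteSpace Hardy :=
  coeffIsometry.toIsometryEquiv.completeSpace

end Hardy

/-! ### Bounded analytic functions, analytic Toeplitz operators, inner projections -/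

/-- `φ` is a bounded analytic function on the open unit disc; its values outside the disc play
no role. -/
structure IsHInfty (φ : ℂ → ℂ) : Prop where
  differentiableOn : DifferentiableOn ℂ φ (Metric.ball 0 1)
  bounded : ∃ M : ℝ, ∀ z ∈ Metric.ball (0 : ℂ) 1, ‖φ z‖ ≤ M

lemma IsHInfty.exists_bound {φ : ℂ → ℂ} (hφ : IsHInfty φ) :
    ∃ M : ℝ, 0 ≤ M ∧ ∀ z : 𝔻, ‖φ z‖ ≤ M := by
  obtain ⟨M, hM⟩ := hφ.bounded
  have h : ∀ z : 𝔻, ‖φ z‖ ≤ M := fun z => hM z (by simpa using z.norm_lt_one)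
  exact ⟨M, (norm_nonneg _).trans (h 0), h⟩

lemma IsHInfty.exists_mul_series {φ : ℂ → ℂ} (hφ : IsHInfty φ) (f : Hardy) :
    ∃ b : ℕ → ℂ, ∀ z : 𝔻, HasSum (fun n => b n * (z : ℂ) ^ n) (φ z * f z) := by
  let c : ℕ → ℂ := fun n => ((n.factorial : ℂ))⁻¹ * iteratedDeriv n φ 0
  have hc : ∀ z : 𝔻, HasSum (fun n => c n * (z : ℂ) ^ n) (φ z) := fun z => by
    have h := Complex.hasSum_taylorSeries_on_ball hφ.differentiableOn
      (z := (z : ℂ)) (by simpa using z.norm_lt_one)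
    have e : ∀ n : ℕ, ((n.factorial : ℂ))⁻¹ • ((z : ℂ) - 0) ^ n • iteratedDeriv n φ 0
        = c n * (z : ℂ) ^ n := fun n => by
      simp only [c, sub_zero, smul_eq_mul]
      ring
    simpa only [e] using h
  refine ⟨fun n => ∑ kl ∈ Finset.HasAntidiagonal.antidiagonal n, c kl.1 * f.coeff kl.2, fun z => ?_⟩
  have h1 := (hc z).summable.norm
  have h2 := (f.hasSum_coeff z).summable.norm
  have h3 := tsum_mul_tsum_eq_tsum_sum_antidiagonal_of_summable_norm h1 h2
  have h4 := (summable_norm_sum_mul_antidiagonal_of_summable_norm h1 h2).of_norm.hasSum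
  rw [← h3, (hc z).tsum_eq, (f.hasSum_coeff z).tsum_eq] at h4
  have e : ∀ n : ℕ, ∑ kl ∈ Finset.HasAntidiagonal.antidiagonal n,
      c kl.1 * (z : ℂ) ^ kl.1 * (f.coeff kl.2 * (z : ℂ) ^ kl.2)
      = (∑ kl ∈ Finset.HasAntidiagonal.antidiagonal n, c kl.1 * f.coeff kl.2) * (z : ℂ) ^ n := by
    intro n
    rw [Finset.sum_mul]
    refine Finset.sum_congr rfl fun kl hkl => ?_
    rw [← Finset.HasAntidiagonal.mem_antidiagonal.1 hkl, pow_add]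
    ring
  simpa only [e] using h4

lemma IsHInfty.mul_mem {φ : ℂ → ℂ} (hφ : IsHInfty φ) (f : Hardy) :
    (fun z : 𝔻 => φ z * f z) ∈ hardySubmodule := by
  obtain ⟨b, hb⟩ := hφ.exists_mul_series f
  obtain ⟨M, hM0, hM⟩ := hφ.exists_bound
  exact ⟨b, (summable_sq_of_disc f.hasSum_coeff hb f.summable_coeff (M := M)
    (fun z => by rw [norm_mul]; exact mul_le_mul_of_nonneg_right (hM z) (norm_nonneg _))).1, hb⟩

/-- Multiplication by a bounded analytic function, as a linear map of the Hardy space. -/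
def toeplitzLinear (φ : ℂ → ℂ) (hφ : IsHInfty φ) : Hardy →ₗ[ℂ] Hardy where
  toFun f := ⟨fun z => φ z * f z, hφ.mul_mem f⟩
  map_add' f g := Hardy.ext fun z => mul_add (φ z) (f z) (g z)
  map_smul' c f := Hardy.ext fun z => mul_left_comm (φ z) c (f z)

lemma toeplitzLinear_bound (φ : ℂ → ℂ) (hφ : IsHInfty φ) :
    ∃ M : ℝ, ∀ f : Hardy, ‖toeplitzLinear φ hφ f‖ ≤ M * ‖f‖ := by
  obtain ⟨M, hM0, hM⟩ := hφ.exists_bound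
  refine ⟨M, fun f => ?_⟩
  have h := (summable_sq_of_disc f.hasSum_coeff (toeplitzLinear φ hφ f).hasSum_coeff
    f.summable_coeff (M := M) (fun z => by
      change ‖φ z * f z‖ ≤ _
      rw [norm_mul]; exact mul_le_mul_of_nonneg_right (hM z) (norm_nonneg _))).2
  rw [← Hardy.norm_sq_eq, ← Hardy.norm_sq_eq, ← mul_pow] at h
  exact le_of_sq_le_sq h (by positivity)

/-- The analytic Toeplitz operator `T_φ f = φ f` on `H²(𝔻)`. -/
def toeplitz (φ : ℂ → ℂ) (hφ : IsHInfty φ) : Hardy →L[ℂ] Hardy :=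
  (toeplitzLinear φ hφ).mkContinuousOfExistsBound (toeplitzLinear_bound φ hφ)

@[simp] lemma toeplitz_apply (φ : ℂ → ℂ) (hφ : IsHInfty φ) (f : Hardy) (z : 𝔻) :
    toeplitz φ hφ f z = φ z * f z := rfl

lemma isHInfty_id : IsHInfty (fun z => z) :=
  ⟨differentiableOn_id, 1, fun z hz => by simpa using (mem_ball_zero_iff.1 hz).le⟩

/-- The shift `T_z` on `H²(𝔻)`. -/
def shift : Hardy →L[ℂ] Hardy := toeplitz (fun z => z) isHInfty_id

/-- The subspace `S` is invariant under the shift `T_z`. -/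
def IsShiftInvariant (S : Submodule ℂ Hardy) : Prop := ∀ f ∈ S, shift f ∈ S

/-- An inner function: a bounded analytic function on the disc whose radial limit exists and is
unimodular at almost every point `e^{it}` of the unit circle (for Lebesgue measure in `t`). -/
structure IsInner (φ : ℂ → ℂ) : Prop extends IsHInfty φ where
  radial_limit : ∀ᵐ t : ℝ, ∃ w : ℂ, ‖w‖ = 1 ∧
    Tendsto (fun r : ℝ => φ (r * Complex.exp (t * Complex.I))) (𝓝[<] 1) (𝓝 w)

/-- An inner projection: an operator of the form `T_φ T_φ^*` with `φ` inner (this is the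
orthogonal projection onto `φ H²(𝔻)`). -/
def IsInnerProjection (P : Hardy →L[ℂ] Hardy) : Prop :=
  ∃ (φ : ℂ → ℂ) (hφ : IsInner φ),
    P = (toeplitz φ hφ.toIsHInfty) ∘L (toeplitz φ hφ.toIsHInfty).adjoint

/-- `T` is a product of two inner projections. -/
def IsProductOfTwoInnerProjections (T : Hardy →L[ℂ] Hardy) : Prop :=
  ∃ P Q : Hardy →L[ℂ] Hardy, IsInnerProjection P ∧ IsInnerProjection Q ∧ T = P ∘L Q

end

noncomputable section

open Filter Topology Complex
open scoped Complex.UnitDisc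

/-! Write `T = PQ`, `K = ker T` and `S = T_z`. Since `K` is `S`-invariant, `Kᗮ` is `S*`-invariant,
and it is nonzero because `T ≠ 0` and `K` is closed. As `ker Q ⊆ K`, the range of `Q` contains `Kᗮ`.
That range is `S`-invariant, so for `f ∈ Kᗮ` with `f(0) ≠ 0` it contains `f - S S* f = f(0)`, hence
the constants, hence all polynomials: `Q = 1`. Now `K = ker P`, and the same argument gives `P = 1`,
contradicting `T ≠ 1`. This is `IsInnerProjection.eq_one_of_invariant`, applied twice. The analytic
input is `adjoint_toeplitz_comp_self`: the radial-limit definition of an inner function yields `T_φ*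
T_φ = 1`, so `T_φ T_φ*` is an orthogonal projection with `S`-invariant range. -/

namespace Hardy

/-! ### Monomials, and Parseval's identity on circles -/

/-- The monomial `zⁿ` as an element of the Hardy space. -/
def monomial (n : ℕ) : Hardy :=
  ⟨fun z => (z : ℂ) ^ n, fun k => if k = n then 1 else 0,
    (hasSum_single (f := fun k => ‖(if k = n then 1 else 0 : ℂ)‖ ^ 2) n
      (fun k hk => by simp [hk])).summable, fun z => by
    have h := hasSum_single (f := fun k => (if k = n then 1 else 0 : ℂ) * (z : ℂ) ^ k) n
      (fun k hk => by simp [hk])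
    simpa using h⟩

lemma monomial_apply (n : ℕ) (z : 𝔻) : monomial n z = (z : ℂ) ^ n := rfl

lemma coeff_monomial (n : ℕ) : (monomial n).coeff = fun k => if k = n then 1 else 0 :=
  coeff_eq fun z => by
    have h := hasSum_single (f := fun k => (if k = n then 1 else 0 : ℂ) * (z : ℂ) ^ k) n
      (fun k hk => by simp [hk])
    simpa [monomial_apply] using h

lemma inner_monomial (n : ℕ) (f : Hardy) : inner ℂ (monomial n) f = f.coeff n := by
  rw [inner_eq, coeff_monomial, tsum_eq_single n (fun k hk => by simp [hk])]
  simp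

lemma ext_inner_monomial {f g : Hardy}
    (h : ∀ n, inner ℂ (monomial n) f = inner ℂ (monomial n) g) : f = g := by
  refine coeffEquiv.injective (Subtype.ext (funext fun n => ?_))
  simpa [inner_monomial] using h n

lemma shift_monomial (n : ℕ) : shift (monomial n) = monomial (n + 1) :=
  ext fun z => by
    simp only [shift, toeplitz_apply, monomial_apply]
    ring

lemma dense_span_monomial : Dense (Submodule.span ℂ (Set.range monomial) : Set Hardy) := by
  rw [Submodule.dense_iff_topologicalClosure_eq_top, Submodule.topologicalClosure_eq_top_iff,
    Submodule.eq_bot_iff]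
  intro f hf
  refine ext_inner_monomial fun n => ?_
  rw [inner_zero_right]
  exact (Submodule.mem_orthogonal _ _).1 hf _ (Submodule.subset_span ⟨n, rfl⟩)

/-- Provides a dense class of bounded functions, on which dominated convergence applies. -/
lemma exists_bound_of_mem_span_monomial {f : Hardy}
    (hf : f ∈ Submodule.span ℂ (Set.range monomial)) : ∃ C : ℝ, ∀ z, ‖f z‖ ≤ C := by
  induction hf using Submodule.span_induction with
  | mem x hx =>
    obtain ⟨n, rfl⟩ := hx
    refine ⟨1, fun z => ?_⟩
    rw [monomial_apply, norm_pow]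
    exact pow_le_one₀ (norm_nonneg _) z.norm_lt_one.le
  | zero => exact ⟨0, fun z => by simp⟩
  | add x y _ _ hx hy =>
    obtain ⟨C, hC⟩ := hx
    obtain ⟨D, hD⟩ := hy
    exact ⟨C + D, fun z => (norm_add_le _ _).trans (add_le_add (hC z) (hD z))⟩
  | smul c x _ hx =>
    obtain ⟨C, hC⟩ := hx
    refine ⟨‖c‖ * C, fun z => ?_⟩
    rw [smul_apply, norm_mul]
    exact mul_le_mul_of_nonneg_left (hC z) (norm_nonneg _)

/-- Parseval's identity on the circle of radius `r < 1`. -/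
lemma integral_norm_sq_circlePoint (f : Hardy) {r : ℝ} (hr0 : 0 ≤ r) (hr : r < 1) :
    Continuous (fun t => f (circlePoint r hr0 hr t)) ∧
    ∫ t, ‖f (circlePoint r hr0 hr t)‖ ^ 2 ∂(AddCircle.haarAddCircle (T := (1 : ℝ)))
      = ∑' n, ‖f.coeff n * (r : ℂ) ^ n‖ ^ 2 := by
  obtain ⟨G, hG, hG2⟩ := summable_sq_parseval _
    (summable_norm_of_disc (fun z => (f.hasSum_coeff z).summable) hr0 hr)
  have eG : (G : AddCircle (1 : ℝ) → ℂ) = fun t => f (circlePoint r hr0 hr t) := by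
    funext t
    refine (hG t).unique ?_
    convert f.hasSum_coeff (circlePoint r hr0 hr t) using 2 with n
    change _ = f.coeff n * ((r : ℂ) * (AddCircle.toCircle t : ℂ)) ^ n
    ring
  refine ⟨eG ▸ G.continuous, ?_⟩
  rw [hG2.tsum_eq]
  apply Complex.ofReal_injective
  rw [Complex.ofReal_pow, ← Complex.coe_algebraMap, ← inner_self_eq_norm_sq_to_K (𝕜 := ℂ),
    MeasureTheory.L2.inner_def, Complex.coe_algebraMap, ← integral_complex_ofReal]
  refine MeasureTheory.integral_congr_ae ?_
  filter_upwards [ContinuousMap.coeFn_toLp (p := 2) (𝕜 := ℂ)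
    (AddCircle.haarAddCircle (T := (1 : ℝ))) G] with t h1
  rw [h1, eG, inner_self_eq_norm_sq_to_K]
  simp

lemma tendsto_tsum_coeff_mul_pow (f : Hardy) :
    Tendsto (fun r : ℝ => ∑' n, ‖f.coeff n * (r : ℂ) ^ n‖ ^ 2) (𝓝[<] 1) (𝓝 (‖f‖ ^ 2)) := by
  rw [norm_sq_eq]
  refine tendsto_tsum_of_dominated_convergence f.summable_coeff (fun n => ?_) ?_
  · have : Continuous (fun r : ℝ => ‖f.coeff n * (r : ℂ) ^ n‖ ^ 2) := by fun_prop
    simpa using (this.tendsto 1).mono_left nhdsWithin_le_nhds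
  · filter_upwards [Ioo_mem_nhdsLT (zero_lt_one' ℝ)] with r hr n
    rw [Real.norm_of_nonneg (by positivity)]
    refine pow_le_pow_left₀ (norm_nonneg _) ?_ 2
    rw [norm_mul, norm_pow, Complex.norm_real, Real.norm_of_nonneg hr.1.le]
    exact mul_le_of_le_one_right (norm_nonneg _) (pow_le_one₀ hr.1.le hr.2.le)

end Hardy

/-! ### Isometry of multiplication by an inner function -/

/-- The radial limits of an inner function, on the circle with its normalized Haar measure. -/
lemma IsInner.ae_tendsto_norm {φ : ℂ → ℂ} (hφ : IsInner φ) :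
    ∀ᵐ t ∂(AddCircle.haarAddCircle (T := (1 : ℝ))),
      Tendsto (fun r : ℝ => ‖φ (r * (AddCircle.toCircle t : ℂ))‖) (𝓝[<] 1) (𝓝 1) := by
  have hvol : (MeasureTheory.volume : MeasureTheory.Measure (AddCircle (1 : ℝ)))
      = AddCircle.haarAddCircle := by
    simp [AddCircle.volume_eq_smul_haarAddCircle]
  have h1 : ∀ᵐ s : ℝ, Tendsto
      (fun r : ℝ => ‖φ (r * Complex.exp ((2 * Real.pi * s : ℝ) * Complex.I))‖)
      (𝓝[<] 1) (𝓝 1) := by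
    -- The circle is parametrized with period 1, the radial limits by angle; the rescaling by `2π`
    -- preserves null sets.
    have hq : MeasureTheory.Measure.QuasiMeasurePreserving (fun s : ℝ => 2 * Real.pi * s)
        MeasureTheory.volume MeasureTheory.volume := by
      refine ⟨by fun_prop, ?_⟩
      rw [Real.map_volume_mul_left (by positivity)]
      exact MeasureTheory.Measure.smul_absolutelyContinuous
    filter_upwards [hq.ae hφ.radial_limit] with s hs
    obtain ⟨w, hw, hlim⟩ := hs
    simpa [hw] using hlim.norm
  rw [← hvol]
  have hp := AddCircle.measurePreserving_equivIoc (T := (1 : ℝ)) (a := 0)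
  have hI : MeasurableSet (Set.Ioc (0 : ℝ) (0 + 1)) := measurableSet_Ioc
  have h2 : ∀ᵐ s : Set.Ioc (0 : ℝ) (0 + 1) ∂(MeasureTheory.Measure.comap Subtype.val
      MeasureTheory.volume), Tendsto
      (fun r : ℝ => ‖φ (r * Complex.exp ((2 * Real.pi * s : ℝ) * Complex.I))‖)
      (𝓝[<] 1) (𝓝 1) := by
    have h3 := MeasureTheory.ae_restrict_of_ae (s := Set.Ioc (0 : ℝ) (0 + 1)) h1
    rw [← map_comap_subtype_coe hI] at h3
    exact MeasureTheory.ae_of_ae_map measurable_subtype_coe.aemeasurable h3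
  filter_upwards [hp.quasiMeasurePreserving.ae h2] with t ht
  have e : (AddCircle.toCircle t : ℂ)
      = Complex.exp ((2 * Real.pi * (AddCircle.equivIoc (1 : ℝ) 0 t : ℝ) : ℝ) * Complex.I) := by
    conv_lhs => rw [← (AddCircle.equivIoc (1 : ℝ) 0).symm_apply_apply t]
    change ((AddCircle.toCircle (((AddCircle.equivIoc (1 : ℝ) 0 t : ℝ)) : AddCircle (1 : ℝ)) :
      Circle) : ℂ) = _
    rw [AddCircle.toCircle_apply_mk, Circle.coe_exp]
    simp
  rw [e]
  exact ht

/-- Integrate `(|φ|² - 1)|f|²` over the circle of radius `r` and let `r → 1`. The limit is `0` by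
dominated convergence, since `|φ| → 1` almost everywhere, and it is `‖φf‖² - ‖f‖²` by Parseval. -/
lemma norm_toeplitz_of_bounded {φ : ℂ → ℂ} (hφ : IsInner φ) {f : Hardy} {C : ℝ}
    (hf : ∀ z, ‖f z‖ ≤ C) : ‖toeplitz φ hφ.toIsHInfty f‖ = ‖f‖ := by
  set g := toeplitz φ hφ.toIsHInfty f with hg
  obtain ⟨M, hM0, hM⟩ := hφ.toIsHInfty.exists_bound
  have hC : 0 ≤ C := (norm_nonneg _).trans (hf 0)
  -- `circlePoint` needs a proof of `0 ≤ r < 1`; the default value `0` is never met near `1` from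
  -- the left.
  let D : ℝ → AddCircle (1 : ℝ) → ℝ := fun r t =>
    if h : 0 ≤ r ∧ r < 1 then
      ‖g (circlePoint r h.1 h.2 t)‖ ^ 2 - ‖f (circlePoint r h.1 h.2 t)‖ ^ 2
    else 0
  have hDeq : ∀ r (h : r ∈ Set.Ioo (0 : ℝ) 1), D r = fun t =>
      ‖g (circlePoint r h.1.le h.2 t)‖ ^ 2 - ‖f (circlePoint r h.1.le h.2 t)‖ ^ 2 :=
    fun r h => funext fun t => dif_pos ⟨h.1.le, h.2⟩
  have hmem : ∀ᶠ r : ℝ in 𝓝[<] 1, r ∈ Set.Ioo (0 : ℝ) 1 := Ioo_mem_nhdsLT (zero_lt_one' ℝ)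
  have hDf : ∀ r (h : r ∈ Set.Ioo (0 : ℝ) 1) t, D r t =
      (‖φ (r * (AddCircle.toCircle t : ℂ))‖ ^ 2 - 1) *
        ‖f (circlePoint r h.1.le h.2 t)‖ ^ 2 := fun r h t => by
    have e : g (circlePoint r h.1.le h.2 t)
        = φ (r * (AddCircle.toCircle t : ℂ)) * f (circlePoint r h.1.le h.2 t) := rfl
    rw [hDeq r h]
    simp only [e, norm_mul]
    ring
  have hlim : Tendsto (fun r => ∫ t, D r t ∂(AddCircle.haarAddCircle (T := (1 : ℝ)))) (𝓝[<] 1)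
      (𝓝 (∫ _, (0 : ℝ) ∂(AddCircle.haarAddCircle (T := (1 : ℝ))))) := by
    refine MeasureTheory.tendsto_integral_filter_of_dominated_convergence
      (fun _ => (M ^ 2 + 1) * C ^ 2) ?_ ?_ (MeasureTheory.integrable_const _) ?_
    · filter_upwards [hmem] with r hr
      rw [hDeq r hr]
      exact (((g.integral_norm_sq_circlePoint hr.1.le hr.2).1.norm.pow 2).sub
        ((f.integral_norm_sq_circlePoint hr.1.le hr.2).1.norm.pow 2)).aestronglyMeasurable
    · filter_upwards [hmem] with r hr
      refine Eventually.of_forall fun t => ?_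
      rw [hDf r hr t, norm_mul, Real.norm_of_nonneg (sq_nonneg ‖f _‖)]
      have h1 : ‖φ (r * (AddCircle.toCircle t : ℂ))‖ ^ 2 ≤ M ^ 2 :=
        pow_le_pow_left₀ (norm_nonneg _) (hM (circlePoint r hr.1.le hr.2 t)) 2
      refine mul_le_mul ?_ (pow_le_pow_left₀ (norm_nonneg _) (hf _) 2) (by positivity)
        (by positivity)
      rw [Real.norm_eq_abs, abs_le]
      constructor <;> nlinarith [sq_nonneg ‖φ (r * (AddCircle.toCircle t : ℂ))‖, sq_nonneg M]
    · filter_upwards [hφ.ae_tendsto_norm] with t ht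
      have h1 : Tendsto (fun r : ℝ => |‖φ (r * (AddCircle.toCircle t : ℂ))‖ ^ 2 - 1| * C ^ 2)
          (𝓝[<] 1) (𝓝 0) := by
        simpa using ((ht.pow 2).sub_const 1).abs.mul_const (C ^ 2)
      refine squeeze_zero_norm' ?_ h1
      filter_upwards [hmem] with r hr
      rw [hDf r hr t, norm_mul, Real.norm_of_nonneg (sq_nonneg ‖f _‖), Real.norm_eq_abs]
      exact mul_le_mul_of_nonneg_left (pow_le_pow_left₀ (norm_nonneg _) (hf _) 2) (abs_nonneg _)
  have hlim2 : Tendsto (fun r => ∫ t, D r t ∂(AddCircle.haarAddCircle (T := (1 : ℝ)))) (𝓝[<] 1)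
      (𝓝 (‖g‖ ^ 2 - ‖f‖ ^ 2)) := by
    refine (g.tendsto_tsum_coeff_mul_pow.sub f.tendsto_tsum_coeff_mul_pow).congr' ?_
    filter_upwards [hmem] with r hr
    obtain ⟨cg, ig⟩ := g.integral_norm_sq_circlePoint hr.1.le hr.2
    obtain ⟨cf, jf⟩ := f.integral_norm_sq_circlePoint hr.1.le hr.2
    rw [hDeq r hr, MeasureTheory.integral_sub, ig, jf]
    · exact (cg.norm.pow 2).integrable_of_hasCompactSupport (HasCompactSupport.of_compactSpace _)
    · exact (cf.norm.pow 2).integrable_of_hasCompactSupport (HasCompactSupport.of_compactSpace _)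
  have h := tendsto_nhds_unique hlim hlim2
  rw [MeasureTheory.integral_zero] at h
  exact (sq_eq_sq₀ (norm_nonneg _) (norm_nonneg _)).1 (sub_eq_zero.1 h.symm)

/-- Multiplication by an inner function is isometric. -/
lemma adjoint_toeplitz_comp_self {φ : ℂ → ℂ} (hφ : IsInner φ) :
    (toeplitz φ hφ.toIsHInfty).adjoint ∘L toeplitz φ hφ.toIsHInfty = 1 := by
  rw [← ContinuousLinearMap.norm_map_iff_adjoint_comp_self]
  intro f
  -- The isometry identity is a closed condition, so polynomials suffice.
  have hc : IsClosed {f : Hardy | ‖toeplitz φ hφ.toIsHInfty f‖ = ‖f‖} :=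
    isClosed_eq (by fun_prop) (by fun_prop)
  refine hc.closure_subset_iff.2 (fun f hf => ?_) (Hardy.dense_span_monomial f)
  obtain ⟨C, hC⟩ := Hardy.exists_bound_of_mem_span_monomial hf
  exact norm_toeplitz_of_bounded hφ hC

/-! ### The shift and its adjoint on Taylor coefficients -/

lemma isInner_id : IsInner (fun z => z) where
  toIsHInfty := isHInfty_id
  radial_limit := Eventually.of_forall fun t => by
    refine ⟨Complex.exp (t * Complex.I), Complex.norm_exp_ofReal_mul_I t, ?_⟩
    have : Continuous (fun r : ℝ => (r : ℂ) * Complex.exp (t * Complex.I)) := by fun_prop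
    simpa using (this.tendsto 1).mono_left nhdsWithin_le_nhds

lemma adjoint_shift_shift (f : Hardy) : shift.adjoint (shift f) = f :=
  DFunLike.congr_fun (adjoint_toeplitz_comp_self isInner_id) f

lemma shift_toeplitz (φ : ℂ → ℂ) (hφ : IsHInfty φ) (f : Hardy) :
    shift (toeplitz φ hφ f) = toeplitz φ hφ (shift f) :=
  Hardy.ext fun z => mul_left_comm (z : ℂ) (φ z) (f z)

lemma coeff_adjoint_shift (f : Hardy) (n : ℕ) : (shift.adjoint f).coeff n = f.coeff (n + 1) := by
  rw [← Hardy.inner_monomial, ← Hardy.inner_monomial, ContinuousLinearMap.adjoint_inner_right,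
    Hardy.shift_monomial]

lemma coeff_shift_succ (f : Hardy) (n : ℕ) : (shift f).coeff (n + 1) = f.coeff n := by
  rw [← coeff_adjoint_shift, adjoint_shift_shift]

lemma coeff_shift_zero (f : Hardy) : (shift f).coeff 0 = 0 := by
  have h : shift.adjoint (Hardy.monomial 0) = 0 := Hardy.ext_inner_monomial fun n => by
    rw [Hardy.inner_monomial, coeff_adjoint_shift, Hardy.coeff_monomial, inner_zero_right]
    simp
  rw [← Hardy.inner_monomial, ← ContinuousLinearMap.adjoint_inner_left, h, inner_zero_left]

/-- `S S*` projects onto the functions vanishing at the origin; what remains is the constant term.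
-/
lemma eq_shift_adjoint_add (f : Hardy) :
    f = shift (shift.adjoint f) + f.coeff 0 • Hardy.monomial 0 := by
  refine Hardy.ext_inner_monomial fun n => ?_
  rw [inner_add_right, inner_smul_right]
  simp only [Hardy.inner_monomial, Hardy.coeff_monomial]
  cases n with
  | zero => simp [coeff_shift_zero]
  | succ n => simp [coeff_shift_succ, coeff_adjoint_shift]

/-- A nonzero subspace that is invariant under the backward shift contains a function that does
not vanish at the origin. -/
lemma exists_coeff_zero_ne_zero {N : Submodule ℂ Hardy} (hN : ∀ f ∈ N, shift.adjoint f ∈ N)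
    (hN0 : N ≠ ⊥) : ∃ f ∈ N, f.coeff 0 ≠ 0 := by
  by_contra! h
  refine hN0 ((Submodule.eq_bot_iff _).2 fun f hf => Hardy.ext_inner_monomial fun n => ?_)
  rw [Hardy.inner_monomial, inner_zero_right]
  -- The `n`-th coefficient of `f` is the constant term of `S*ⁿ f`, which stays in `N`.
  induction n generalizing f with
  | zero => exact h f hf
  | succ n ih => rw [← coeff_adjoint_shift]; exact ih _ (hN f hf)

/-! ### Inner projections and their ranges -/

namespace IsInnerProjection

variable {P : Hardy →L[ℂ] Hardy}

lemma apply_apply (hP : IsInnerProjection P) (f : Hardy) : P (P f) = P f := by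
  obtain ⟨φ, hφ, rfl⟩ := hP
  simp only [ContinuousLinearMap.comp_apply]
  exact congrArg _ (DFunLike.congr_fun (adjoint_toeplitz_comp_self hφ) _)

lemma inner_left (hP : IsInnerProjection P) (f g : Hardy) :
    inner ℂ (P f) g = inner ℂ f (P g) := by
  obtain ⟨φ, hφ, rfl⟩ := hP
  simp only [ContinuousLinearMap.comp_apply]
  rw [← ContinuousLinearMap.adjoint_inner_right, ContinuousLinearMap.adjoint_inner_left]

/-- The vectors fixed by `P` are the multiples of `φ`, and multiplication by `z` commutes with
multiplication by `φ`. -/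
lemma shift_of_apply_eq (hP : IsInnerProjection P) {f : Hardy} (hf : P f = f) :
    P (shift f) = shift f := by
  obtain ⟨φ, hφ, rfl⟩ := hP
  simp only [ContinuousLinearMap.comp_apply] at hf ⊢
  rw [← hf, shift_toeplitz]
  exact congrArg _ (DFunLike.congr_fun (adjoint_toeplitz_comp_self hφ) _)

/-- The difference `f - P f` lies in `ker P ⊆ K`, so it is orthogonal to `f` and to `P f`, hence to
itself. -/
lemma apply_of_mem_orthogonal (hP : IsInnerProjection P) {K : Submodule ℂ Hardy}
    (hK : ∀ f, P f = 0 → f ∈ K) {f : Hardy} (hf : f ∈ Kᗮ) : P f = f := by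
  have h0 : P (f - P f) = 0 := by rw [map_sub, hP.apply_apply, sub_self]
  have h1 : inner ℂ (f - P f) f = 0 := (Submodule.mem_orthogonal _ _).1 hf _ (hK _ h0)
  have h2 : inner ℂ (f - P f) (P f) = 0 := by rw [← hP.inner_left, h0, inner_zero_left]
  have h3 : inner ℂ (f - P f) (f - P f) = 0 := by rw [inner_sub_right, h1, h2, sub_zero]
  exact (sub_eq_zero.1 (inner_self_eq_zero.1 h3)).symm

/-- The range of an inner projection contains no nonzero subspace invariant under the backward
shift, unless it is the whole space. -/
lemma eq_one_of_invariant (hP : IsInnerProjection P) {N : Submodule ℂ Hardy}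
    (hN : ∀ f ∈ N, shift.adjoint f ∈ N) (hN0 : N ≠ ⊥) (hPN : ∀ f ∈ N, P f = f) : P = 1 := by
  obtain ⟨f, hf, hf0⟩ := exists_coeff_zero_ne_zero hN hN0
  have h0 : P (Hardy.monomial 0) = Hardy.monomial 0 := by
    -- The constant `1` is a combination of `f` and `S S* f`; both are fixed by `P`, as `f` and `S*
    -- f` lie in `N`.
    have h1 : Hardy.monomial 0 = (f.coeff 0)⁻¹ • (f - shift (shift.adjoint f)) := by
      rw [sub_eq_iff_eq_add'.2 (eq_shift_adjoint_add f), inv_smul_smul₀ hf0]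
    rw [h1, map_smul, map_sub, hPN f hf, hP.shift_of_apply_eq (hPN _ (hN f hf))]
  have hn : ∀ n, P (Hardy.monomial n) = Hardy.monomial n := fun n => by
    induction n with
    | zero => exact h0
    | succ n ih => rw [← Hardy.shift_monomial]; exact hP.shift_of_apply_eq ih
  -- By self-adjointness, `P g` has the same Taylor coefficients as `g`.
  refine ContinuousLinearMap.ext fun g => Hardy.ext_inner_monomial fun n => ?_
  rw [← hP.inner_left, hn]
  rfl

end IsInnerProjection

theorem mainTheorem12 (T : Hardy →L[ℂ] Hardy) (hT0 : T ≠ 0) (hT1 : T ≠ 1)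
    (hker : IsShiftInvariant (LinearMap.ker (T : Hardy →ₗ[ℂ] Hardy))) :
    ¬ IsProductOfTwoInnerProjections T := by
  rintro ⟨P, Q, hP, hQ, rfl⟩
  set K := LinearMap.ker ((P ∘L Q : Hardy →L[ℂ] Hardy) : Hardy →ₗ[ℂ] Hardy) with hK
  have hN : ∀ f ∈ Kᗮ, shift.adjoint f ∈ Kᗮ := fun f hf => by
    rw [Submodule.mem_orthogonal] at hf ⊢
    intro k hk
    rw [ContinuousLinearMap.adjoint_inner_right]
    exact hf _ (hker k hk)
  have hKc : IsClosed (K : Set Hardy) := (P ∘L Q).isClosed_ker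
  -- Completeness turns `Kᗮ = ⊥` into `K = ⊤`, that is, `T = 0`.
  have : CompleteSpace K := hKc.completeSpace_coe
  have hN0 : Kᗮ ≠ ⊥ := fun h => hT0 <| ContinuousLinearMap.ext fun f => by
    have hf : f ∈ K := by rw [(Submodule.orthogonal_eq_bot_iff).1 h]; trivial
    exact hf
  have hQ1 : Q = 1 := hQ.eq_one_of_invariant hN hN0 fun f hf =>
    hQ.apply_of_mem_orthogonal (K := K) (fun g hg => by
      change P (Q g) = 0
      rw [hg, map_zero]) hf
  -- The inclusion `ker P ⊆ K` is available only once `Q = 1` is known.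
  have hP1 : P = 1 := hP.eq_one_of_invariant hN hN0 fun f hf =>
    hP.apply_of_mem_orthogonal (K := K) (fun g hg => by
      change P (Q g) = 0
      rw [hQ1]
      exact hg) hf
  exact hT1 (by rw [hP1, hQ1]; rfl)

end
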